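/- For an array $A[1,\dots,n]$ over a totally ordered set, an interval $[i,j]\subseteq[1,n]$ and $q\ge 1$, let $p_1<\dots<p_k$ be the positions of the minimum elements of $A[i,\dots,j]$. The range $q$-th minimum query $\mathsf{RMin}(i,j,q)$ returns $p_q$ if $q\le k$ and $p_k$ if $q>k$; the range $q$-th maximum query $\mathsf{RMax}(i,j,q)$ is defined analogously with maximum elements. A Baxter permutation is a permutation avoiding the patterns $2\text{-}41\text{-}3$ and $3\text{-}14\text{-}2$, in which the two entries not separated by a dash must be adjacent. For $n\ge 2$ let $\mathcal A_n$ be the set of all arrays of size $n$ obtained as follows: for some $0\le k\le n-1$ pick any $k$ positions in $\{2,\dots,n\}$, write a Baxter permutation of $\{1,\dots,n-k\}$, from left to right, on the other $n-k$ positions, and assign to each picked position the value at the rightmost non-picked position to its left. (1) For every $n\ge 2$, every array $A\in\mathcal A_n$ can be reconstructed from the answers to all range $q$-th minimum and maximum queries on $A$: there is a map, depending only on $n$, which sends the answers on $A$ to $A$, for every $A\in\mathcal A_n$. (2) There is a function $f(n)=\Theta(\log n)$ such that for all $n\ge 2$ $$\log_2|\mathcal A_n|\;\ge\; n\log_2 9-f(n)\;\ge\;3.16\,n-f(n),$$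 and any encoding of arrays of size $n$ that supports range $q$-th minimum and maximum queries needs at least $n\log_2 9-f(n)\ge 3.16\,n-f(n)$ bits. That is, let $S\supseteq\mathcal A_n$ be any set of arrays of natural numbers of size $n$ (for example all of them), and let each $A\in S$ be mapped to a finite bit string from which, without access to $A$, the answers to all range $q$-th minimum and maximum queries on $A$ can be determined; then the bit string of some $A\in\mathcal A_n$ has length at least $n\log_2 9-f(n)$. -/

import Mathlib

/-- A range query on an array of size `n`: a nonempty interval `[lo, hi]` of positions and a
number `q ≥ 1`. Positions are counted from `0`. -/
structure RangeQuery (n : ℕ) where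
  lo : Fin n
  hi : Fin n
  q : ℕ
  lo_le_hi : lo ≤ hi
  one_le_q : 1 ≤ q

/-- The positions of the minimum elements of `A[i, …, j]`. -/
def minPositions {n : ℕ} {α : Type*} [LinearOrder α] (A : Fin n → α) (i j : Fin n) :
    Finset (Fin n) :=
  (Finset.Icc i j).filter (fun p => ∀ r ∈ Finset.Icc i j, A p ≤ A r)

theorem minPositions_card_pos {n : ℕ} {α : Type*} [LinearOrder α] (A : Fin n → α)
    {i j : Fin n} (h : i ≤ j) : 0 < (minPositions A i j).card := by
  obtain ⟨p, hp, hmin⟩ := Finset.exists_min_image (Finset.Icc i j) A ⟨i, by simp [h]⟩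
  exact Finset.card_pos.mpr ⟨p, Finset.mem_filter.mpr ⟨hp, hmin⟩⟩

/-- The answer to a range `q`-th minimum query: if `p_1 < … < p_k` are the positions of the
minimum elements in the interval, the answer is `p_q` if `q ≤ k`, and `p_k` if `q > k`. -/
def rangeMin {n : ℕ} {α : Type*} [LinearOrder α] (A : Fin n → α) (Q : RangeQuery n) : Fin n :=
  (minPositions A Q.lo Q.hi).orderEmbOfFin rfl
    ⟨min Q.q (minPositions A Q.lo Q.hi).card - 1, by
      have h1 := minPositions_card_pos A Q.lo_le_hi
      omega⟩

/-- The answer to a range `q`-th maximum query: the `q`-th minimum for the reversed order of the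
values (the order of the positions is unchanged). -/
def rangeMax {n : ℕ} {α : Type*} [LinearOrder α] (A : Fin n → α) (Q : RangeQuery n) : Fin n :=
  rangeMin (fun p => OrderDual.toDual (A p)) Q

/-- Baxter permutations: those avoiding the patterns `2-41-3` and `3-14-2`, where the two middle
entries `j`, `j'` of an occurrence have to be adjacent. -/
def IsBaxter {m : ℕ} (π : Equiv.Perm (Fin m)) : Prop :=
  ∀ i j j' l : Fin m, i < j → (j' : ℕ) = (j : ℕ) + 1 → j' < l →
    ¬ (π j' < π i ∧ π i < π l ∧ π l < π j) ∧
    ¬ (π j < π l ∧ π l < π i ∧ π i < π j')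

/-- The class of arrays of size `n` obtained by picking a set `D` of `k` positions, none of them
the first one, writing a Baxter permutation of `{1, …, m}`, `m = n - k`, on the remaining
positions from left to right, and giving each picked position the value at the rightmost
position to its left that is not picked. -/
def baxterArrays (n : ℕ) : Set (Fin n → ℕ) :=
  {A | ∃ (D : Finset (Fin n)) (m : ℕ) (hm : Dᶜ.card = m) (π : Equiv.Perm (Fin m)),
    (∀ p ∈ D, 0 < (p : ℕ)) ∧ IsBaxter π ∧
    (∀ t : Fin m, A (Dᶜ.orderEmbOfFin hm t) = (π t : ℕ) + 1) ∧
    (∀ p ∈ D, ∀ r, r ∉ D → r < p → (∀ s, r < s → s < p → s ∈ D) → A p = A r)}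

/-- `enc` is an encoding of the arrays in `S` that supports range `q`-th minimum and maximum
queries: the answers to all queries on `A` can be determined from the bit string `enc A`
alone, without access to `A`. -/
def SupportsRangeQueries {n : ℕ} (S : Set (Fin n → ℕ)) (enc : S → List Bool) : Prop :=
  ∃ ansMin ansMax : List Bool → RangeQuery n → Fin n,
    ∀ (A : S) (Q : RangeQuery n),
      ansMin (enc A) Q = rangeMin (A : Fin n → ℕ) Q ∧
      ansMax (enc A) Q = rangeMax (A : Fin n → ℕ) Q

/-! Two facts carry the theorem: the queries determine an array of the class, and the class has at
least `9 ^ n` members up to a polynomial factor.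

Reconstruction. Varying `q` reveals all minimum and maximum positions of every interval. By
induction on the distance this fixes the relative order of any two positions
(`IsBaxterArray.sameOrder`). If an end of the interval is extremal, the queries compare the ends
directly. Otherwise a minimum and a maximum lie strictly inside, and according to which comes first,
avoidance of `3-14-2` or of `2-41-3` makes one strict order of the ends produce an interior position
with value between theirs, through which the comparison reduces to closer pairs. Since the values
are exactly `1, …, m`, the order determines the array.

Counting. An array amounts to a pair of a set `D` and a Baxter permutation of size `n - |D|`. Once
Baxter permutations of size `m` number at least `8 ^ m` up to a polynomial factor, the binomial
theorem turns the sum over `D` into `9 ^ (n - 1)`. To bound the Baxter permutations from below, a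
new maximum is inserted just before a left-to-right maximum or just after a right-to-left maximum;
the numbers of these maxima evolve by the rule of `treePaths`. Graded by the number of steps of the
first kind, the paths are counted by a 3 × 3 determinant of binomials, which at the root is a
rational multiple of the cube of one binomial; the middle grade alone gives `8 ^ m`.

An encoding is injective on the class, and fewer than `2 ^ (K + 1)` bit strings have length at most
`K`. -/

/-! ### Counting tree paths by a determinant of binomial coefficients. -/

/-- Binomial coefficients with an integer lower index. -/
noncomputable def zchoose (n : ℕ) (k : ℤ) : ℝ := if k < 0 then 0 else (n.choose k.toNat : ℝ)

theorem zchoose_natCast (n k : ℕ) : zchoose n k = n.choose k := by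
  simp [zchoose]

theorem zchoose_of_neg (n : ℕ) {k : ℤ} (h : k < 0) : zchoose n k = 0 := by
  simp [zchoose, h]

theorem zchoose_zero (k : ℤ) : zchoose 0 k = if k = 0 then 1 else 0 := by
  rcases lt_or_ge k 0 with h | h
  · rw [zchoose_of_neg _ h, if_neg h.ne]
  · lift k to ℕ using h
    cases k with
    | zero => simp [zchoose]
    | succ k => rw [zchoose_natCast, if_neg (by omega)]; simp

theorem zchoose_zero_right (n : ℕ) : zchoose n 0 = 1 := by
  simp [zchoose]

theorem zchoose_succ (n : ℕ) (k : ℤ) :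
    zchoose (n + 1) k = zchoose n (k - 1) + zchoose n k := by
  rcases lt_or_ge k 0 with h | h
  · rw [zchoose_of_neg _ h, zchoose_of_neg _ h, zchoose_of_neg _ (by omega), add_zero]
  · lift k to ℕ using h
    cases k with
    | zero => simp [zchoose]
    | succ k =>
      have : ((k + 1 : ℕ) : ℤ) - 1 = (k : ℕ) := by push_cast; ring
      rw [this]
      simp only [zchoose_natCast]
      rw [Nat.choose_succ_succ]; push_cast; ring

theorem zchoose_symm (n : ℕ) (k : ℤ) : zchoose n (n - k) = zchoose n k := by
  rcases lt_or_ge k 0 with h | h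
  · obtain ⟨t, ht⟩ : ∃ t : ℕ, (n : ℤ) - k = t := ⟨(n - k).toNat, by omega⟩
    rw [ht, zchoose_of_neg _ h, zchoose_natCast, Nat.choose_eq_zero_of_lt (by omega)]; simp
  · lift k to ℕ using h
    rcases lt_or_ge n k with h | h
    · rw [zchoose_natCast, Nat.choose_eq_zero_of_lt h, zchoose_of_neg _ (by omega)]; simp
    · rw [← Nat.cast_sub h, zchoose_natCast, zchoose_natCast, Nat.choose_symm h]

theorem zchoose_succ_right (n : ℕ) (k : ℤ) :
    ((k : ℝ) + 1) * zchoose n (k + 1) = (n - k) * zchoose n k := by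
  rcases lt_trichotomy k (-1) with h | h | h
  · rw [zchoose_of_neg _ (by omega), zchoose_of_neg _ (by omega)]; simp
  · subst h; simp [zchoose]
  · lift k to ℕ using (by omega)
    have : ((k : ℤ) + 1) = (k + 1 : ℕ) := by push_cast; ring
    rw [this]
    simp only [zchoose_natCast]
    rcases le_or_gt k n with hk | hk
    · have := Nat.choose_succ_right_eq n k
      have h2 : ((n.choose (k + 1) * (k + 1) : ℕ) : ℝ) = (n.choose k * (n - k) : ℕ) := by rw [this]
      push_cast [Nat.cast_sub hk] at h2 ⊢
      linarith
    · rw [Nat.choose_eq_zero_of_lt hk, Nat.choose_eq_zero_of_lt (by omega)]; simp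

/-- The number of paths of length `m` below a node labelled `(i, j)` in the tree in which a node
labelled `(i, j)` has children `(1, j + 1), …, (i, j + 1), (i + 1, 1), …, (i + 1, j)`. -/
def treePaths : ℕ → ℕ → ℕ → ℕ
  | 0, _, _ => 1
  | m + 1, i, j => ∑ t ∈ Finset.range i, treePaths m (t + 1) (j + 1) +
      ∑ t ∈ Finset.range j, treePaths m (i + 1) (t + 1)

/-- The paths counted by `treePaths` with exactly `k` steps of the first kind. -/
def gradedTreePaths : ℕ → ℤ → ℕ → ℕ → ℕ
  | 0, k, _, _ => if k = 0 then 1 else 0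
  | m + 1, k, i, j => ∑ t ∈ Finset.range i, gradedTreePaths m (k - 1) (t + 1) (j + 1) +
      ∑ t ∈ Finset.range j, gradedTreePaths m k (i + 1) (t + 1)

theorem sum_gradedTreePaths_le (m : ℕ) : ∀ (K : Finset ℤ) (i j : ℕ),
    ∑ k ∈ K, gradedTreePaths m k i j ≤ treePaths m i j := by
  induction m with
  | zero =>
    intro K i j
    simp only [gradedTreePaths, treePaths, Finset.sum_ite_eq']
    split_ifs <;> simp
  | succ m ih =>
    intro K i j
    simp only [gradedTreePaths, treePaths, Finset.sum_add_distrib]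
    rw [Finset.sum_comm, Finset.sum_comm (s := K) (t := Finset.range j)]
    refine add_le_add (Finset.sum_le_sum fun t _ => ?_) (Finset.sum_le_sum fun t _ => ih _ _ _)
    -- A step of the first kind lowers the grade by one, so the set of grades is shifted.
    refine le_trans (le_of_eq ?_) (ih (K.image (· - 1)) _ _)
    rw [Finset.sum_image (by intro a _ b _ h; simpa using h)]

/-- The determinant of the `3 × 3` matrix with rows `a`, `b`, `c` and columns `1, 0, -1`. -/
def det₃ (a b c : ℤ → ℝ) : ℝ :=
  a 1 * (b 0 * c (-1) - b (-1) * c 0) - a 0 * (b 1 * c (-1) - b (-1) * c 1) +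
    a (-1) * (b 1 * c 0 - b 0 * c 1)

/-- The closed form of `gradedTreePaths m k (i + 1) (j + 1)`. -/
noncomputable def pathDet (m : ℕ) (k : ℤ) (i j : ℕ) : ℝ :=
  det₃ (fun x => zchoose (m + i) (k + x - 1)) (fun x => zchoose m (k + x))
    (fun x => zchoose (m + j) (m - k - x - 1))

/-- The sum telescopes: by Pascal's rule in the first row and linearity in that row, each summand is
the increment of the right side. At `i = 0` the first two rows coincide. -/
theorem sum_pathDet_left (m : ℕ) (k : ℤ) (i j : ℕ) :
    ∑ t ∈ Finset.range i, pathDet m (k - 1) t (j + 1) =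
      det₃ (fun x => zchoose (m + i) (k + x - 1)) (fun x => zchoose m (k + x - 1))
        (fun x => zchoose (m + 1 + j) (m + 1 - k - x - 1)) := by
  induction i with
  | zero => simp only [det₃, Finset.range_zero, Finset.sum_empty, add_zero]; ring
  | succ i ih =>
    rw [Finset.sum_range_succ, ih, pathDet]
    simp only [det₃, ← add_assoc m i 1, zchoose_succ (m + i)]
    rw [show m + (j + 1) = m + 1 + j by ring]
    ring_nf

/-- The same telescoping in the third row; at `j = 0` the symmetry of the binomials makes the last
two rows equal. -/
theorem sum_pathDet_right (m : ℕ) (k : ℤ) (i j : ℕ) :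
    ∑ t ∈ Finset.range j, pathDet m k (i + 1) t =
      det₃ (fun x => zchoose (m + 1 + i) (k + x - 1)) (fun x => zchoose m (k + x))
        (fun x => zchoose (m + j) (m + 1 - k - x - 1)) := by
  induction j with
  | zero =>
    have h : ∀ x : ℤ, zchoose m (m + 1 - k - x - 1) = zchoose m (k + x) := fun x => by
      rw [← zchoose_symm m (k + x)]; congr 1; ring
    simp only [det₃, Finset.range_zero, Finset.sum_empty, add_zero, h]; ring
  | succ j ih =>
    rw [Finset.sum_range_succ, ih, pathDet]
    simp only [det₃, ← add_assoc m j 1, zchoose_succ (m + j)]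
    rw [show m + (i + 1) = m + 1 + i by ring]
    ring_nf

theorem gradedTreePaths_eq_pathDet (m : ℕ) : ∀ (k : ℤ) (i j : ℕ),
    (gradedTreePaths m k (i + 1) (j + 1) : ℝ) = pathDet m k i j := by
  induction m with
  | zero =>
    intro k i j
    simp only [gradedTreePaths, pathDet, det₃, zchoose_zero]
    by_cases h0 : k = 0
    · subst h0
      simp [zchoose_of_neg, zchoose_zero_right]
    · by_cases h1 : k = 1
      · subst h1; simp [zchoose_of_neg]
      · by_cases h2 : k = -1
        · subst h2; simp [zchoose_of_neg]
        · rw [if_neg h0, if_neg (by omega), if_neg (by omega), if_neg (by omega)]; simp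
  | succ m ih =>
    intro k i j
    simp only [gradedTreePaths, Nat.cast_add, Nat.cast_sum, ih]
    rw [sum_pathDet_left, sum_pathDet_right, pathDet]
    -- The two sums differ only in the middle row, so Pascal's rule there merges them into one
    -- determinant.
    simp only [det₃, zchoose_succ m, Nat.cast_add, Nat.cast_one]
    rw [show m + (i + 1) = m + 1 + i by ring, show m + (j + 1) = m + 1 + j by ring]
    ring_nf

/-- Only the five binomials with lower index `a - 2, …, a + 2` occur, each a rational multiple of
the middle one. -/
theorem pathDet_zero_zero (a b : ℕ) :
    pathDet (a + b) a 0 0 = ((a + b).choose a : ℝ) ^ 3 * (2 * (a + b + 1) ^ 2 * (a + b + 2)) /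
      ((a + 1) ^ 2 * (a + 2) * ((b + 1) ^ 2 * (b + 2))) := by
  set c : ℝ := ((a + b).choose a : ℝ) with hc
  have z0 : zchoose (a + b) a = c := zchoose_natCast _ _
  have z1 : zchoose (a + b) (a + 1) = b * c / (a + 1) := by
    have := zchoose_succ_right (a + b) a
    rw [z0] at this
    rw [eq_div_iff (by positivity), mul_comm]
    push_cast at this ⊢
    linarith
  have z2 : zchoose (a + b) (a + 2) = b * (b - 1) * c / ((a + 1) * (a + 2)) := by
    have := zchoose_succ_right (a + b) (a + 1)
    rw [z1, show (a : ℤ) + 1 + 1 = a + 2 by ring] at this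
    have h2 : ((a : ℝ) + 2) ≠ 0 := by positivity
    have h3 : ((a : ℝ) + 1) ≠ 0 := by positivity
    field_simp at this ⊢
    push_cast at this
    linarith
  have y1 : zchoose (a + b) (a - 1) = a * c / (b + 1) := by
    have := zchoose_succ_right (a + b) (a - 1)
    rw [sub_add_cancel, z0] at this
    rw [eq_div_iff (by positivity)]
    push_cast at this ⊢
    linarith
  have y2 : zchoose (a + b) (a - 2) = a * (a - 1) * c / ((b + 1) * (b + 2)) := by
    have := zchoose_succ_right (a + b) (a - 2)
    rw [show (a : ℤ) - 2 + 1 = a - 1 by ring, y1] at this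
    have h2 : ((b : ℝ) + 2) ≠ 0 := by positivity
    have h3 : ((b : ℝ) + 1) ≠ 0 := by positivity
    field_simp at this ⊢
    push_cast at this
    linarith
  have hs : ∀ x : ℤ, zchoose (a + b) (((a + b : ℕ) : ℤ) - a - x - 1) =
      zchoose (a + b) (a + x + 1) := fun x => by
    rw [← zchoose_symm (a + b) (a + x + 1)]; congr 1; ring
  simp only [pathDet, det₃, add_zero, hs]
  rw [show (a : ℤ) + 1 - 1 = a by ring, show (a : ℤ) + -1 + 1 = a by ring,
    show (a : ℤ) + -1 = a - 1 by ring, show (a : ℤ) + 1 + 1 = a + 2 by ring,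
    show (a : ℤ) - 1 - 1 = a - 2 by ring, z0, z1, z2, y1, y2]
  have h2 : ((b : ℝ) + 2) ≠ 0 := by positivity
  have h3 : ((b : ℝ) + 1) ≠ 0 := by positivity
  have h4 : ((a : ℝ) + 2) ≠ 0 := by positivity
  have h5 : ((a : ℝ) + 1) ≠ 0 := by positivity
  field_simp
  ring

theorem two_pow_le_mul_choose_half (m : ℕ) : 2 ^ m ≤ (m + 1) * m.choose (m / 2) := by
  rw [← Nat.sum_range_choose]
  refine (Finset.sum_le_card_nsmul _ _ _ fun k _ => Nat.choose_le_middle k m).trans ?_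
  simp

theorem eight_pow_le_treePaths (m : ℕ) :
    (8 : ℝ) ^ m ≤ (m + 2) ^ 6 * treePaths m 1 1 := by
  obtain ⟨b, hb⟩ : ∃ b, m = m / 2 + b := ⟨m - m / 2, by omega⟩
  set a := m / 2 with ha
  have h1 : (gradedTreePaths m a 1 1 : ℝ) ≤ treePaths m 1 1 := by
    have := sum_gradedTreePaths_le m {(a : ℤ)} 1 1
    rw [Finset.sum_singleton] at this
    exact_mod_cast this
  have h2 : (gradedTreePaths m a 1 1 : ℝ) = pathDet (a + b) a 0 0 := by
    rw [← hb]; exact gradedTreePaths_eq_pathDet m a 0 0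
  rw [pathDet_zero_zero, ← hb] at h2
  have h3 : (2 : ℝ) ^ m ≤ (m + 1) * m.choose a := by exact_mod_cast two_pow_le_mul_choose_half m
  have hm : (m : ℝ) = a + b := by exact_mod_cast hb
  set c : ℝ := (m.choose a : ℝ)
  have hc : 0 ≤ c := Nat.cast_nonneg _
  have h4 : (8 : ℝ) ^ m ≤ ((m + 1) * c) ^ 3 := by
    calc (8 : ℝ) ^ m = (2 ^ m) ^ 3 := by rw [← pow_mul, mul_comm m 3, pow_mul]; norm_num
      _ ≤ _ := by gcongr
  have h5 : c ^ 3 ≤ (m + 2) ^ 3 * (gradedTreePaths m a 1 1 : ℝ) := by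
    rw [h2, ← mul_div_assoc, le_div_iff₀ (by positivity)]
    -- The bounds are shaped so that `(m + 1) ^ 2` and `2 * (m + 2)` match the numerator of the
    -- closed form, leaving `(m + 2) ^ 3`.
    have e1 : (a + 1 : ℝ) * (b + 1) ≤ (m + 1) ^ 2 := by
      rw [hm]; nlinarith [(Nat.cast_nonneg a : (0 : ℝ) ≤ a), (Nat.cast_nonneg b : (0 : ℝ) ≤ b)]
    have e2 : (a + 1 : ℝ) * (b + 1) ≤ (m + 2) ^ 2 := by
      rw [hm]; nlinarith [(Nat.cast_nonneg a : (0 : ℝ) ≤ a), (Nat.cast_nonneg b : (0 : ℝ) ≤ b)]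
    have e3 : (a + 2 : ℝ) * (b + 2) ≤ 2 * (m + 2) * (m + 2) := by
      rw [hm]; nlinarith [(Nat.cast_nonneg a : (0 : ℝ) ≤ a), (Nat.cast_nonneg b : (0 : ℝ) ≤ b)]
    calc c ^ 3 * ((a + 1 : ℝ) ^ 2 * (a + 2) * ((b + 1) ^ 2 * (b + 2)))
        = c ^ 3 * (((a + 1 : ℝ) * (b + 1)) * ((a + 1 : ℝ) * (b + 1)) * ((a + 2) * (b + 2))) := by
          ring
      _ ≤ c ^ 3 * ((m + 1) ^ 2 * (m + 2) ^ 2 * (2 * (m + 2) * (m + 2))) := by gcongr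
      _ = (m + 2) ^ 3 * (c ^ 3 * (2 * (a + b + 1) ^ 2 * (a + b + 2))) := by rw [hm]; ring
  calc (8 : ℝ) ^ m ≤ ((m + 1) * c) ^ 3 := h4
    _ = (m + 1) ^ 3 * c ^ 3 := by ring
    _ ≤ (m + 2) ^ 3 * ((m + 2) ^ 3 * (gradedTreePaths m a 1 1 : ℝ)) := by
      gcongr
      linarith
    _ ≤ (m + 2) ^ 3 * ((m + 2) ^ 3 * (treePaths m 1 1 : ℝ)) := by gcongr
    _ = _ := by ring

/-! ### Growing Baxter permutations by inserting a maximum. -/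

/-- Insert a new maximum at position `p` of the permutation `π`. -/
def insertMax {n : ℕ} (p : Fin (n + 1)) (π : Equiv.Perm (Fin n)) : Equiv.Perm (Fin (n + 1)) :=
  (finSuccEquiv' p).trans ((Equiv.optionCongr π).trans (finSuccEquiv' (Fin.last n)).symm)

theorem insertMax_self {n : ℕ} (p : Fin (n + 1)) (π : Equiv.Perm (Fin n)) :
    insertMax p π p = Fin.last n := by
  simp [insertMax]

theorem insertMax_succAbove {n : ℕ} (p : Fin (n + 1)) (π : Equiv.Perm (Fin n)) (t : Fin n) :
    insertMax p π (p.succAbove t) = (π t).castSucc := by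
  simp [insertMax]

theorem insertMax_inj {n : ℕ} {p q : Fin (n + 1)} {π ρ : Equiv.Perm (Fin n)}
    (h : insertMax p π = insertMax q ρ) : p = q ∧ π = ρ := by
  have hpq : p = q := by
    apply (insertMax q ρ).injective
    rw [insertMax_self, ← h, insertMax_self]
  subst hpq
  refine ⟨rfl, Equiv.ext fun t => ?_⟩
  have := insertMax_succAbove p π t
  rw [h, insertMax_succAbove] at this
  exact (Fin.castSucc_injective _ this).symm

/-- The positions of the left-to-right maxima. -/
def leftMaxima {n : ℕ} (π : Equiv.Perm (Fin n)) : Finset (Fin n) :=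
  Finset.univ.filter fun p => ∀ q < p, π q < π p

/-- The positions of the right-to-left maxima. -/
def rightMaxima {n : ℕ} (π : Equiv.Perm (Fin n)) : Finset (Fin n) :=
  Finset.univ.filter fun p => ∀ q, p < q → π q < π p

theorem mem_leftMaxima {n : ℕ} {π : Equiv.Perm (Fin n)} {p : Fin n} :
    p ∈ leftMaxima π ↔ ∀ q < p, π q < π p := by
  simp [leftMaxima]

theorem mem_rightMaxima {n : ℕ} {π : Equiv.Perm (Fin n)} {p : Fin n} :
    p ∈ rightMaxima π ↔ ∀ q, p < q → π q < π p := by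
  simp [rightMaxima]

/-- The permutation read from right to left. -/
def reversePerm {n : ℕ} (π : Equiv.Perm (Fin n)) : Equiv.Perm (Fin n) := Fin.revPerm.trans π

theorem reversePerm_apply {n : ℕ} (π : Equiv.Perm (Fin n)) (p : Fin n) :
    reversePerm π p = π p.rev := rfl

theorem reversePerm_reversePerm {n : ℕ} (π : Equiv.Perm (Fin n)) :
    reversePerm (reversePerm π) = π := by
  ext p; simp [reversePerm_apply]

theorem card_leftMaxima_reversePerm {n : ℕ} (π : Equiv.Perm (Fin n)) :
    (leftMaxima (reversePerm π)).card = (rightMaxima π).card := by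
  rw [← Finset.card_map (s := rightMaxima π) Fin.revPerm.toEmbedding]
  congr 1
  ext p
  rw [Finset.mem_map_equiv, Fin.revPerm_symm, Fin.revPerm_apply, mem_leftMaxima, mem_rightMaxima]
  simp only [reversePerm_apply]
  constructor
  · intro h q hq
    have := h q.rev (Fin.rev_lt_iff.mpr hq)
    simpa using this
  · intro h q hq
    exact h q.rev (Fin.rev_lt_rev.mpr hq)

theorem IsBaxter.reversePerm {n : ℕ} {π : Equiv.Perm (Fin n)} (h : IsBaxter π) :
    IsBaxter (reversePerm π) := by
  intro i j j' l hij hj hl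
  have := h l.rev j'.rev j.rev i.rev (Fin.rev_lt_rev.mpr hl)
    (by rw [Fin.val_rev, Fin.val_rev]; omega) (Fin.rev_lt_rev.mpr hij)
  simp only [reversePerm_apply]
  tauto

theorem succAbove_castSucc_of_lt' {n : ℕ} {p t : Fin n} (h : t < p) :
    p.castSucc.succAbove t = t.castSucc :=
  Fin.succAbove_of_castSucc_lt _ _ (by simpa using h)

theorem succAbove_castSucc_of_ge {n : ℕ} {p t : Fin n} (h : p ≤ t) :
    p.castSucc.succAbove t = t.succ :=
  Fin.succAbove_of_le_castSucc _ _ (by simpa using h)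

theorem val_succAbove_castSucc {n : ℕ} (p t : Fin n) :
    (p.castSucc.succAbove t : ℕ) = if (t : ℕ) < p then (t : ℕ) else t + 1 := by
  split_ifs with h
  · rw [succAbove_castSucc_of_lt' h]; rfl
  · rw [succAbove_castSucc_of_ge (not_lt.mp h)]; rfl

/-- The new maximum could only be the `4` of a pattern. In `2-41-3` the `1` would then be the
left-to-right maximum `p`, which exceeds the `2`. In `3-14-2` the entry `p` either is the `2`, again
too large, or can replace the `4`, giving an occurrence in `π`. Insertion creates no new adjacency
among old entries. -/
theorem IsBaxter.insertMax {n : ℕ} {π : Equiv.Perm (Fin n)} (h : IsBaxter π) {p : Fin n}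
    (hp : p ∈ leftMaxima π) : IsBaxter (insertMax p.castSucc π) := by
  have hmax : ∀ q < p, π q < π p := mem_leftMaxima.mp hp
  intro i j j' l hij hj hl
  have hle : ∀ x, ¬ Fin.last n < x := fun x => not_lt.mpr (Fin.le_last x)
  rcases Fin.eq_self_or_eq_succAbove p.castSucc i with rfl | ⟨i, rfl⟩
  · rw [insertMax_self]
    exact ⟨fun hh => hle _ hh.2.1, fun hh => hle _ hh.2.2⟩
  rcases Fin.eq_self_or_eq_succAbove p.castSucc l with rfl | ⟨l, rfl⟩
  · rw [insertMax_self]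
    exact ⟨fun hh => hle _ hh.2.2, fun hh => hle _ hh.2.1⟩
  rcases Fin.eq_self_or_eq_succAbove p.castSucc j with rfl | ⟨j, rfl⟩
  · rcases Fin.eq_self_or_eq_succAbove p.castSucc j' with rfl | ⟨j', rfl⟩
    · omega
    rw [insertMax_self]
    refine ⟨fun hh => ?_, fun hh => hle _ hh.1⟩
    simp only [insertMax_succAbove, Fin.castSucc_lt_castSucc_iff] at hh
    rw [Fin.lt_def, val_succAbove_castSucc] at hij
    rw [val_succAbove_castSucc, Fin.val_castSucc] at hj
    rw [Fin.val_castSucc] at hij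
    have e : j' = p := by ext; split_ifs at hj <;> omega
    subst e
    exact lt_asymm hh.1 (hmax i (by rw [Fin.lt_def]; split_ifs at hij <;> omega))
  · rcases Fin.eq_self_or_eq_succAbove p.castSucc j' with rfl | ⟨j', rfl⟩
    · rw [insertMax_self]
      refine ⟨fun hh => hle _ hh.1, fun hh => ?_⟩
      simp only [insertMax_succAbove, Fin.castSucc_lt_castSucc_iff] at hh
      rw [Fin.lt_def] at hij hl
      simp only [val_succAbove_castSucc, Fin.val_castSucc] at hij hj hl
      have hip : i < p := by rw [Fin.lt_def]; split_ifs at hij hj <;> omega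
      have hjp : (p : ℕ) = j + 1 := by split_ifs at hj <;> omega
      have hij' : i < j := by rw [Fin.lt_def]; split_ifs at hij hj <;> omega
      rcases eq_or_ne l p with rfl | hne
      · exact lt_asymm hh.2.1 (hmax i hip)
      · have hpl : p < l := by
          have : (l : ℕ) ≠ p := fun hh => hne (Fin.ext hh)
          rw [Fin.lt_def]; split_ifs at hl <;> omega
        exact (h i j p l hij' hjp hpl).2 ⟨hh.1, hh.2.1, hmax i hip⟩
    · simp only [insertMax_succAbove, Fin.castSucc_lt_castSucc_iff]
      rw [Fin.lt_def] at hij hl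
      simp only [val_succAbove_castSucc] at hij hj hl
      apply h i j j' l
      · rw [Fin.lt_def]; split_ifs at hij <;> omega
      · split_ifs at hj <;> omega
      · rw [Fin.lt_def]; split_ifs at hl <;> omega

theorem card_leftMaxima_insertMax {n : ℕ} (π : Equiv.Perm (Fin n)) (p : Fin n) :
    (leftMaxima (insertMax p.castSucc π)).card = ((leftMaxima π).filter (· < p)).card + 1 := by
  have e : leftMaxima (insertMax p.castSucc π) =
      insert p.castSucc (((leftMaxima π).filter (· < p)).map Fin.castSuccEmb) := by
    ext x
    simp only [mem_leftMaxima, Finset.mem_filter, Finset.mem_insert, Finset.mem_map,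
      Fin.coe_castSuccEmb]
    rcases Fin.eq_self_or_eq_succAbove p.castSucc x with rfl | ⟨t, rfl⟩
    · simp only [true_or, iff_true, insertMax_self]
      intro q hq
      rcases Fin.eq_self_or_eq_succAbove p.castSucc q with rfl | ⟨s, rfl⟩
      · exact absurd hq (lt_irrefl _)
      · rw [insertMax_succAbove]; exact Fin.castSucc_lt_last _
    · rw [or_iff_right (Fin.succAbove_ne _ _)]
      rcases lt_or_ge t p with h | h
      · constructor
        · intro hh
          refine ⟨t, ⟨fun q hq => ?_, h⟩, (succAbove_castSucc_of_lt' h).symm⟩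
          have := hh (p.castSucc.succAbove q) (Fin.succAbove_lt_succAbove_iff.mpr hq)
          simpa [insertMax_succAbove] using this
        · rintro ⟨s, ⟨hs, -⟩, hst⟩ q hq
          rw [succAbove_castSucc_of_lt' h] at hst
          have hst := Fin.castSucc_injective _ hst
          subst hst
          rcases Fin.eq_self_or_eq_succAbove p.castSucc q with rfl | ⟨u, rfl⟩
          · rw [succAbove_castSucc_of_lt' h] at hq
            exact absurd h (lt_asymm (by simpa using hq))
          · simp only [insertMax_succAbove, Fin.castSucc_lt_castSucc_iff]
            exact hs u (Fin.succAbove_lt_succAbove_iff.mp hq)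
      · constructor
        · intro hh
          have := hh p.castSucc (by
            rw [succAbove_castSucc_of_ge h, Fin.lt_def]; simpa [Nat.lt_succ_iff] using h)
          rw [insertMax_self] at this
          exact absurd this (not_lt.mpr (Fin.le_last _))
        · rintro ⟨s, ⟨-, hs⟩, hst⟩
          rw [succAbove_castSucc_of_ge h] at hst
          have := congrArg Fin.val hst
          simp only [Fin.val_castSucc, Fin.val_succ] at this
          rw [Fin.lt_def] at hs
          rw [Fin.le_def] at h
          omega
  rw [e, Finset.card_insert_of_notMem, Finset.card_map]
  simp

theorem card_rightMaxima_insertMax {n : ℕ} {π : Equiv.Perm (Fin n)} {p : Fin n}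
    (hp : p ∈ leftMaxima π) :
    (rightMaxima (insertMax p.castSucc π)).card = (rightMaxima π).card + 1 := by
  have hmax : ∀ q < p, π q < π p := mem_leftMaxima.mp hp
  have e : rightMaxima (insertMax p.castSucc π) =
      insert p.castSucc ((rightMaxima π).map p.castSucc.succAboveEmb) := by
    ext x
    simp only [mem_rightMaxima, Finset.mem_insert, Finset.mem_map,
      Fin.coe_succAboveEmb]
    rcases Fin.eq_self_or_eq_succAbove p.castSucc x with rfl | ⟨t, rfl⟩
    · simp only [true_or, iff_true, insertMax_self]
      intro q hq
      rcases Fin.eq_self_or_eq_succAbove p.castSucc q with rfl | ⟨s, rfl⟩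
      · exact absurd hq (lt_irrefl _)
      · rw [insertMax_succAbove]; exact Fin.castSucc_lt_last _
    · rw [or_iff_right (Fin.succAbove_ne _ _)]
      constructor
      · intro hh
        refine ⟨t, fun q hq => ?_, rfl⟩
        have := hh (p.castSucc.succAbove q) (Fin.succAbove_lt_succAbove_iff.mpr hq)
        simpa [insertMax_succAbove] using this
      · rintro ⟨s, hs, hst⟩ q hq
        have hst := Fin.succAbove_right_injective hst
        subst hst
        rcases Fin.eq_self_or_eq_succAbove p.castSucc q with rfl | ⟨u, rfl⟩
        -- A right-to-left maximum before `p` would exceed `π p`, against `p` being a left-to-right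
        -- maximum; so none is lost.
        · have hsp : s < p := by
            by_contra hc
            rw [succAbove_castSucc_of_ge (not_lt.mp hc), Fin.lt_def] at hq
            rw [Fin.lt_def] at hc
            simp at hq hc
            omega
          exact absurd (hs p hsp) (lt_asymm (hmax s hsp))
        · simp only [insertMax_succAbove, Fin.castSucc_lt_castSucc_iff]
          exact hs u (Fin.succAbove_lt_succAbove_iff.mp hq)
  rw [e, Finset.card_insert_of_notMem, Finset.card_map]
  simp [Fin.succAbove_ne]

/-- The number of elements of `S` below `p` takes each value `0, …, S.card - 1` once; this
enumerates the labels of the children. -/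
theorem sum_card_filter_lt {α M : Type*} [LinearOrder α] [AddCommMonoid M] (S : Finset α)
    (φ : ℕ → M) :
    ∑ p ∈ S, φ (S.filter (· < p)).card = ∑ t ∈ Finset.range S.card, φ t := by
  induction S using Finset.induction_on_max with
  | empty => simp
  | insert a S ha ih =>
    have hnot : a ∉ S := fun h => lt_irrefl _ (ha a h)
    rw [Finset.sum_insert hnot, Finset.card_insert_of_notMem hnot, Finset.sum_range_succ, ← ih,
      add_comm]
    congr 1
    · refine Finset.sum_congr rfl fun p hp => ?_
      rw [Finset.filter_insert, if_neg (lt_asymm (ha p hp))]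
    · rw [Finset.filter_insert, if_neg (lt_irrefl _), Finset.filter_true_of_mem ha]

open Classical in
/-- The finite set of Baxter permutations of size `n`. -/
noncomputable def baxterPerms (n : ℕ) : Finset (Equiv.Perm (Fin n)) :=
  Finset.univ.filter IsBaxter

theorem mem_baxterPerms {n : ℕ} {π : Equiv.Perm (Fin n)} : π ∈ baxterPerms n ↔ IsBaxter π := by
  simp [baxterPerms]

/-- In a permutation with a new maximum inserted in front of a left-to-right maximum, the largest
of the other entries is to the right of the new maximum. -/
theorem insertMax_ne_reversePerm_insertMax {n : ℕ} {π ρ : Equiv.Perm (Fin n)} {p q : Fin n}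
    (hp : p ∈ leftMaxima π) (hq : q ∈ leftMaxima ρ) :
    insertMax p.castSucc π ≠ reversePerm (insertMax q.castSucc ρ) := by
  intro h
  have hp' : ∀ s < p, π s < π p := mem_leftMaxima.mp hp
  have hq' : ∀ s < q, ρ s < ρ q := mem_leftMaxima.mp hq
  have key : ∀ {π : Equiv.Perm (Fin n)} {p : Fin n} (M : Fin n), (∀ s < p, π s < π p) →
      (∀ s, π s ≤ π M) → ∀ y, insertMax p.castSucc π y = (π M).castSucc → p.castSucc < y := by
    intro π p M hp hM y hy
    have hpM : p ≤ M := not_lt.mp fun hc => absurd (hp M hc) (not_lt.mpr (hM p))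
    rw [← insertMax_succAbove p.castSucc] at hy
    rw [(insertMax _ π).injective hy, succAbove_castSucc_of_ge hpM]
    exact Fin.castSucc_lt_succ_iff.mpr hpM
  have hpos : 0 < n := p.pos
  obtain ⟨n, rfl⟩ : ∃ k, n = k + 1 := ⟨n - 1, by omega⟩
  have hM : ∀ π : Equiv.Perm (Fin (n + 1)), ∀ s, π s ≤ π (π.symm (Fin.last n)) := fun π s => by
    simpa using Fin.le_last _
  set y := (insertMax p.castSucc π).symm (Fin.last n).castSucc with hy
  have h1 := key (π.symm (Fin.last n)) hp' (hM π) y (by simp [hy])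
  have e1 : insertMax q.castSucc ρ y.rev = (Fin.last n).castSucc := by
    rw [← reversePerm_apply, ← h, hy, Equiv.apply_symm_apply]
  have h2 := key (ρ.symm (Fin.last n)) hq' (hM ρ) y.rev (by simp [e1])
  have e2 : p.castSucc = q.castSucc.rev := by
    apply (insertMax p.castSucc π).injective
    rw [insertMax_self, h, reversePerm_apply, Fin.rev_rev, insertMax_self]
  rw [e2, Fin.rev_lt_iff] at h1
  exact lt_asymm h1 h2

/-- Insertions and mirrored insertions are distinct Baxter permutations carrying the labels of the
tree's children. That they exhaust the next level is not needed for a lower bound. -/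
theorem sum_children_le (n : ℕ) (g : ℕ → ℕ → ℕ) :
    ∑ π ∈ baxterPerms n,
      (∑ t ∈ Finset.range (leftMaxima π).card, g (t + 1) ((rightMaxima π).card + 1) +
        ∑ t ∈ Finset.range (rightMaxima π).card, g ((leftMaxima π).card + 1) (t + 1)) ≤
    ∑ σ ∈ baxterPerms (n + 1), g (leftMaxima σ).card (rightMaxima σ).card := by
  classical
  set G : Equiv.Perm (Fin (n + 1)) → ℕ := fun σ => g (leftMaxima σ).card (rightMaxima σ).card
    with hG
  set S₁ := (baxterPerms n).sigma fun π => leftMaxima π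
  set S₂ := (baxterPerms n).sigma fun π => leftMaxima (reversePerm π)
  set f₁ : (Σ _ : Equiv.Perm (Fin n), Fin n) → Equiv.Perm (Fin (n + 1)) :=
    fun x => insertMax x.2.castSucc x.1 with hf₁
  set f₂ : (Σ _ : Equiv.Perm (Fin n), Fin n) → Equiv.Perm (Fin (n + 1)) :=
    fun x => reversePerm (insertMax x.2.castSucc (reversePerm x.1)) with hf₂
  have inj₁ : Function.Injective f₁ := by
    rintro ⟨π, p⟩ ⟨ρ, q⟩ h
    obtain ⟨h1, h2⟩ := insertMax_inj h
    obtain rfl : p = q := Fin.castSucc_injective _ h1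
    obtain rfl : π = ρ := h2
    rfl
  have rinj : ∀ {k : ℕ}, Function.Injective (reversePerm (n := k)) :=
    fun {k} => (show Function.Involutive (reversePerm (n := k)) from
      reversePerm_reversePerm).injective
  have inj₂ : Function.Injective f₂ := by
    rintro ⟨π, p⟩ ⟨ρ, q⟩ h
    obtain ⟨h1, h2⟩ := insertMax_inj (rinj h)
    obtain rfl : p = q := Fin.castSucc_injective _ h1
    obtain rfl : π = ρ := rinj h2
    rfl
  have card_rm : ∀ {k : ℕ} (σ : Equiv.Perm (Fin k)),
      (rightMaxima (reversePerm σ)).card = (leftMaxima σ).card := fun σ => by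
    rw [← card_leftMaxima_reversePerm, reversePerm_reversePerm]
  have e₁ : ∑ π ∈ baxterPerms n,
      ∑ t ∈ Finset.range (leftMaxima π).card, g (t + 1) ((rightMaxima π).card + 1) =
      ∑ σ ∈ S₁.image f₁, G σ := by
    rw [Finset.sum_image inj₁.injOn, Finset.sum_sigma]
    refine Finset.sum_congr rfl fun π _ => ?_
    rw [← sum_card_filter_lt (leftMaxima π) (fun t => g (t + 1) ((rightMaxima π).card + 1))]
    refine Finset.sum_congr rfl fun p hp => ?_
    simp only [hG, hf₁, card_leftMaxima_insertMax, card_rightMaxima_insertMax hp]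
  have e₂ : ∑ π ∈ baxterPerms n,
      ∑ t ∈ Finset.range (rightMaxima π).card, g ((leftMaxima π).card + 1) (t + 1) =
      ∑ σ ∈ S₂.image f₂, G σ := by
    rw [Finset.sum_image inj₂.injOn, Finset.sum_sigma]
    refine Finset.sum_congr rfl fun π _ => ?_
    rw [← card_leftMaxima_reversePerm, ← sum_card_filter_lt (leftMaxima (reversePerm π))
      (fun t => g ((leftMaxima π).card + 1) (t + 1))]
    refine Finset.sum_congr rfl fun p hp => ?_
    simp only [hG, hf₂, card_leftMaxima_reversePerm, card_rm, card_leftMaxima_insertMax,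
      card_rightMaxima_insertMax hp]
  rw [Finset.sum_add_distrib, e₁, e₂, ← Finset.sum_union]
  · refine Finset.sum_le_sum_of_subset ?_
    intro σ hσ
    rw [mem_baxterPerms]
    rcases Finset.mem_union.mp hσ with h | h <;>
      obtain ⟨⟨π, p⟩, hx, rfl⟩ := Finset.mem_image.mp h <;>
      obtain ⟨hπ, hp⟩ := Finset.mem_sigma.mp hx <;>
      rw [mem_baxterPerms] at hπ
    · exact hπ.insertMax hp
    · exact (hπ.reversePerm.insertMax hp).reversePerm
  · rw [Finset.disjoint_left]
    intro σ h₁ h₂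
    obtain ⟨⟨π, p⟩, hx, rfl⟩ := Finset.mem_image.mp h₁
    obtain ⟨⟨ρ, q⟩, hy, he⟩ := Finset.mem_image.mp h₂
    exact insertMax_ne_reversePerm_insertMax (Finset.mem_sigma.mp hx).2
      (Finset.mem_sigma.mp hy).2 he.symm

theorem sum_treePaths_le (m : ℕ) : ∀ n : ℕ,
    ∑ π ∈ baxterPerms n, treePaths m (leftMaxima π).card (rightMaxima π).card ≤
      (baxterPerms (n + m)).card := by
  induction m with
  | zero => intro n; simp [treePaths]
  | succ m ih =>
    intro n
    simp only [treePaths]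
    refine (sum_children_le n (treePaths m)).trans ((ih (n + 1)).trans (le_of_eq ?_))
    rw [Nat.add_right_comm, Nat.add_assoc]

theorem treePaths_le_card_baxterPerms (m : ℕ) :
    treePaths m 1 1 ≤ (baxterPerms (m + 1)).card := by
  have h := sum_treePaths_le m 1
  rw [add_comm 1 m] at h
  refine le_trans ?_ h
  have hB : (1 : Equiv.Perm (Fin 1)) ∈ baxterPerms 1 := by
    rw [mem_baxterPerms]
    intro i j j' l hij
    exact absurd hij (by simp [Subsingleton.elim i j])
  have hL : (leftMaxima (1 : Equiv.Perm (Fin 1))).card = 1 := by decide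
  have hR : (rightMaxima (1 : Equiv.Perm (Fin 1))).card = 1 := by decide
  have := Finset.single_le_sum (f := fun π : Equiv.Perm (Fin 1) =>
    treePaths m (leftMaxima π).card (rightMaxima π).card) (fun _ _ => Nat.zero_le _) hB
  simpa only [hL, hR] using this

theorem eight_pow_le_card_baxterPerms {n : ℕ} (hn : 1 ≤ n) :
    (8 : ℝ) ^ n ≤ 8 * (n + 1) ^ 6 * (baxterPerms n).card := by
  obtain ⟨m, rfl⟩ : ∃ m, n = m + 1 := ⟨n - 1, by omega⟩
  have h1 := eight_pow_le_treePaths m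
  have h2 : (treePaths m 1 1 : ℝ) ≤ (baxterPerms (m + 1)).card := by
    exact_mod_cast treePaths_le_card_baxterPerms m
  calc (8 : ℝ) ^ (m + 1) = 8 * 8 ^ m := by ring
    _ ≤ 8 * ((m + 2) ^ 6 * (baxterPerms (m + 1)).card) := by
      gcongr
      exact h1.trans (by gcongr)
    _ = _ := by push_cast; ring

/-! ### Arrays as Baxter permutations with repeated entries, and their number. -/

/-- The number of positions `≤ p` outside `D`, minus one: the index in the increasing enumeration
of `Dᶜ` of the last position `≤ p` that is not in `D`. -/
def blockIndex {n : ℕ} (D : Finset (Fin n)) (p : Fin n) : ℕ := (Dᶜ.filter (· ≤ p)).card - 1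

theorem blockIndex_mono {n : ℕ} (D : Finset (Fin n)) : Monotone (blockIndex D) := fun _ _ h =>
  Nat.sub_le_sub_right (Finset.card_le_card
    (Finset.monotone_filter_right _ fun _ _ hx => le_trans hx h)) 1

theorem card_filter_le_pos {n : ℕ} {D : Finset (Fin n)} (hD : ∀ p ∈ D, 0 < (p : ℕ)) (p : Fin n) :
    0 < (Dᶜ.filter (· ≤ p)).card := by
  refine Finset.card_pos.mpr ⟨⟨0, p.pos⟩, ?_⟩
  rw [Finset.mem_filter, Finset.mem_compl]
  exact ⟨fun h => lt_irrefl 0 (hD _ h), Fin.le_def.mpr (Nat.zero_le _)⟩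

theorem blockIndex_lt {n : ℕ} {D : Finset (Fin n)} (hD : ∀ p ∈ D, 0 < (p : ℕ)) (p : Fin n) :
    blockIndex D p < Dᶜ.card := by
  have h1 := card_filter_le_pos hD p
  have h2 := Finset.card_filter_le Dᶜ (· ≤ p)
  unfold blockIndex
  omega

theorem blockIndex_orderEmbOfFin {n m : ℕ} {D : Finset (Fin n)} (hm : Dᶜ.card = m) (t : Fin m) :
    blockIndex D (Dᶜ.orderEmbOfFin hm t) = t := by
  have : Dᶜ.filter (· ≤ Dᶜ.orderEmbOfFin hm t) =
      (Finset.Iic t).map (Dᶜ.orderEmbOfFin hm).toEmbedding := by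
    ext x
    simp only [Finset.mem_filter, Finset.mem_map, Finset.mem_Iic, RelEmbedding.coe_toEmbedding]
    constructor
    · rintro ⟨hx, hle⟩
      have hx' : x ∈ Set.range (Dᶜ.orderEmbOfFin hm) := by
        rw [Finset.range_orderEmbOfFin]; exact hx
      obtain ⟨s, rfl⟩ := hx'
      exact ⟨s, (OrderEmbedding.le_iff_le _).mp hle, rfl⟩
    · rintro ⟨s, hs, rfl⟩
      exact ⟨Finset.orderEmbOfFin_mem _ _ _, (OrderEmbedding.le_iff_le _).mpr hs⟩
  rw [blockIndex, this, Finset.card_map, Fin.card_Iic]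
  rfl

theorem blockIndex_eq_of_forall_mem {n : ℕ} {D : Finset (Fin n)} {r p : Fin n} (h : r ≤ p)
    (hs : ∀ s, r < s → s ≤ p → s ∈ D) : blockIndex D p = blockIndex D r := by
  have : Dᶜ.filter (· ≤ p) = Dᶜ.filter (· ≤ r) := by
    ext x
    simp only [Finset.mem_filter, Finset.mem_compl]
    constructor
    · rintro ⟨hx, hle⟩
      exact ⟨hx, not_lt.mp fun hc => hx (hs x hc hle)⟩
    · rintro ⟨hx, hle⟩
      exact ⟨hx, hle.trans h⟩
  rw [blockIndex, blockIndex, this]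

theorem blockIndex_succ_of_notMem {n : ℕ} {D : Finset (Fin n)} (hD : ∀ p ∈ D, 0 < (p : ℕ))
    {r p : Fin n} (h : (p : ℕ) = r + 1) (hp : p ∉ D) : blockIndex D p = blockIndex D r + 1 := by
  have : Dᶜ.filter (· ≤ p) = insert p (Dᶜ.filter (· ≤ r)) := by
    ext x
    simp only [Finset.mem_filter, Finset.mem_compl, Finset.mem_insert]
    constructor
    · rintro ⟨hx, hle⟩
      rcases hle.eq_or_lt with rfl | hlt
      · exact Or.inl rfl
      · refine Or.inr ⟨hx, ?_⟩
        rw [Fin.lt_def] at hlt; rw [Fin.le_def]; omega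
    · rintro (rfl | ⟨hx, hle⟩)
      · exact ⟨hp, le_rfl⟩
      · refine ⟨hx, ?_⟩
        rw [Fin.le_def] at *; omega
  have hpos := card_filter_le_pos hD r
  rw [blockIndex, blockIndex, this, Finset.card_insert_of_notMem]
  · omega
  · rw [Finset.mem_filter, Fin.le_def]; omega

theorem blockIndex_succ_of_mem {n : ℕ} {D : Finset (Fin n)} {r p : Fin n} (h : (p : ℕ) = r + 1)
    (hp : p ∈ D) : blockIndex D p = blockIndex D r := by
  refine blockIndex_eq_of_forall_mem (by rw [Fin.le_def]; omega) fun s h1 h2 => ?_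
  have : s = p := by
    ext; rw [Fin.lt_def] at h1; rw [Fin.le_def] at h2; omega
  rwa [this]

theorem eq_of_mem_baxterArrays {n m : ℕ} {A : Fin n → ℕ} {D : Finset (Fin n)}
    (hm : Dᶜ.card = m) {π : Equiv.Perm (Fin m)} (hD : ∀ p ∈ D, 0 < (p : ℕ))
    (h1 : ∀ t : Fin m, A (Dᶜ.orderEmbOfFin hm t) = (π t : ℕ) + 1)
    (h2 : ∀ p ∈ D, ∀ r, r ∉ D → r < p → (∀ s, r < s → s < p → s ∈ D) → A p = A r) (p : Fin n) :
    A p = (π ⟨blockIndex D p, hm ▸ blockIndex_lt hD p⟩ : ℕ) + 1 := by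
  have key : ∀ q, q ∉ D → A q = (π ⟨blockIndex D q, hm ▸ blockIndex_lt hD q⟩ : ℕ) + 1 := by
    intro q hq
    have hq' : q ∈ Set.range (Dᶜ.orderEmbOfFin hm) := by
      rw [Finset.range_orderEmbOfFin]; simpa using hq
    obtain ⟨t, rfl⟩ := hq'
    rw [h1]
    congr 3
    ext
    exact (blockIndex_orderEmbOfFin hm t).symm
  by_cases hp : p ∈ D
  · have hne : (Dᶜ.filter (· ≤ p)).Nonempty := Finset.card_pos.mp (card_filter_le_pos hD p)
    set r := (Dᶜ.filter (· ≤ p)).max' hne with hr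
    have hr' : r ∈ Dᶜ.filter (· ≤ p) := Finset.max'_mem _ _
    obtain ⟨hrD, hrp⟩ := Finset.mem_filter.mp hr'
    rw [Finset.mem_compl] at hrD
    have hs : ∀ s, r < s → s ≤ p → s ∈ D := by
      intro s h1 h2
      by_contra hc
      exact absurd (Finset.le_max' (Dᶜ.filter (· ≤ p)) s (by simp [hc, h2])) (not_le.mpr h1)
    have hlt : r < p := lt_of_le_of_ne hrp fun h => hrD (h ▸ hp)
    rw [h2 p hp r hrD hlt fun s h1 h2 => hs s h1 h2.le, key r hrD]
    congr 3
    ext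
    exact (blockIndex_eq_of_forall_mem hrp hs).symm
  · exact key p hp

/-- The array in which the value at `p` is given by the permutation `π` at the block of `p`. -/
def blockArray {n : ℕ} (D : Finset (Fin n)) (hD : ∀ p ∈ D, 0 < (p : ℕ))
    (π : Equiv.Perm (Fin Dᶜ.card)) (p : Fin n) : ℕ :=
  (π ⟨blockIndex D p, blockIndex_lt hD p⟩ : ℕ) + 1

theorem blockArray_mem_baxterArrays {n : ℕ} (D : Finset (Fin n)) (hD : ∀ p ∈ D, 0 < (p : ℕ))
    {π : Equiv.Perm (Fin Dᶜ.card)} (hπ : IsBaxter π) : blockArray D hD π ∈ baxterArrays n := by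
  refine ⟨D, _, rfl, π, hD, hπ, fun t => ?_, fun p hp r _ hrp hs => ?_⟩
  · simp only [blockArray, blockIndex_orderEmbOfFin]
  · have : blockIndex D p = blockIndex D r := blockIndex_eq_of_forall_mem hrp.le fun s h1 h2 =>
      h2.eq_or_lt.elim (fun h => h ▸ hp) (hs s h1)
    simp only [blockArray, this]

theorem exists_blockArray_of_mem {n : ℕ} {A : Fin n → ℕ} (hA : A ∈ baxterArrays n) :
    ∃ (D : Finset (Fin n)) (hD : ∀ p ∈ D, 0 < (p : ℕ)) (π : Equiv.Perm (Fin Dᶜ.card)),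
      IsBaxter π ∧ A = blockArray D hD π := by
  obtain ⟨D, m, hm, π, hD, hπ, h1, h2⟩ := hA
  subst hm
  exact ⟨D, hD, π, hπ, funext (eq_of_mem_baxterArrays rfl hD h1 h2)⟩

theorem blockArray_eq_iff {n : ℕ} {D : Finset (Fin n)} {hD : ∀ p ∈ D, 0 < (p : ℕ)}
    {π : Equiv.Perm (Fin Dᶜ.card)} {p q : Fin n} :
    blockArray D hD π p = blockArray D hD π q ↔ blockIndex D p = blockIndex D q := by
  simp [blockArray, Fin.val_inj]

/-- Neighbouring blocks carry different values, so `D` can be read off the array. -/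
theorem mem_iff_blockArray_eq {n : ℕ} {D : Finset (Fin n)} {hD : ∀ p ∈ D, 0 < (p : ℕ)}
    {π : Equiv.Perm (Fin Dᶜ.card)} {r p : Fin n} (h : (p : ℕ) = r + 1) :
    p ∈ D ↔ blockArray D hD π p = blockArray D hD π r := by
  rw [blockArray_eq_iff]
  by_cases hp : p ∈ D
  · exact iff_of_true hp (blockIndex_succ_of_mem h hp)
  · have := blockIndex_succ_of_notMem hD h hp
    exact iff_of_false hp (by omega)

theorem blockArray_inj {n : ℕ} {D E : Finset (Fin n)} {hD : ∀ p ∈ D, 0 < (p : ℕ)}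
    {hE : ∀ p ∈ E, 0 < (p : ℕ)} {π : Equiv.Perm (Fin Dᶜ.card)} {ρ : Equiv.Perm (Fin Eᶜ.card)}
    (h : blockArray D hD π = blockArray E hE ρ) : D = E ∧ HEq π ρ := by
  have hDE : D = E := by
    ext p
    by_cases h0 : 0 < (p : ℕ)
    · have hp : (p : ℕ) = (⟨p - 1, by omega⟩ : Fin n) + 1 := by simp only; omega
      rw [mem_iff_blockArray_eq (hD := hD) (π := π) hp,
        mem_iff_blockArray_eq (hD := hE) (π := ρ) hp, h]
    · exact iff_of_false (fun hc => h0 (hD p hc)) (fun hc => h0 (hE p hc))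
  subst hDE
  refine ⟨rfl, heq_of_eq (Equiv.ext fun t => ?_)⟩
  have := congrFun h (Dᶜ.orderEmbOfFin rfl t)
  simp only [blockArray, blockIndex_orderEmbOfFin] at this
  exact Fin.ext (by simpa using this)

theorem finite_baxterArrays (n : ℕ) : (baxterArrays n).Finite := by
  refine (Set.Finite.pi' fun _ : Fin n => Set.finite_Iic n).subset fun A hA p => ?_
  obtain ⟨D, hD, π, -, rfl⟩ := exists_blockArray_of_mem hA
  have h1 := (π ⟨blockIndex D p, blockIndex_lt hD p⟩).isLt
  have h2 : Dᶜ.card ≤ n := by simpa using Finset.card_le_univ Dᶜ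
  simp only [blockArray, Set.mem_Iic]
  omega

theorem sum_card_baxterPerms_le (n : ℕ) :
    ∑ D ∈ ((Finset.univ : Finset (Fin n)).filter fun p : Fin n => 0 < (p : ℕ)).powerset,
      (baxterPerms Dᶜ.card).card ≤ (baxterArrays n).ncard := by
  rw [← Finset.card_sigma, ← Set.ncard_coe_finset]
  have hmem : ∀ D ∈ ((Finset.univ : Finset (Fin n)).filter fun p : Fin n => 0 < (p : ℕ)).powerset,
      ∀ p ∈ D, 0 < (p : ℕ) := fun D hD p hp => by
    simpa using Finset.mem_powerset.mp hD hp
  -- The value `0` is a dummy for sets containing the first position, which do not occur in the sum.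
  refine Set.ncard_le_ncard_of_injOn (fun x p =>
    if h : ∀ p ∈ x.1, 0 < (p : ℕ) then blockArray x.1 h x.2 p else 0) ?_ ?_
    (finite_baxterArrays n)
  · rintro ⟨D, π⟩ hx
    obtain ⟨hD, hπ⟩ := Finset.mem_sigma.mp hx
    simp only [dif_pos (hmem D hD)]
    exact blockArray_mem_baxterArrays D _ (mem_baxterPerms.mp hπ)
  · rintro ⟨D, π⟩ hx ⟨E, ρ⟩ hy h
    have hD := hmem D (Finset.mem_sigma.mp hx).1
    have hE := hmem E (Finset.mem_sigma.mp hy).1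
    simp only [dif_pos hD, dif_pos hE] at h
    obtain ⟨rfl, hh⟩ := blockArray_inj (hD := hD) (hE := hE) h
    rw [eq_of_heq hh]

theorem nine_pow_le_ncard_baxterArrays {n : ℕ} (hn : 1 ≤ n) :
    (9 : ℝ) ^ (n - 1) ≤ (n + 1) ^ 6 * (baxterArrays n).ncard := by
  set P := (Finset.univ : Finset (Fin n)).filter fun p : Fin n => 0 < (p : ℕ) with hP
  have hPcard : P.card = n - 1 := by
    have : P = Finset.univ.erase ⟨0, hn⟩ := by
      ext p; simp [hP, Fin.ext_iff, Nat.pos_iff_ne_zero]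
    rw [this, Finset.card_erase_of_mem (Finset.mem_univ _), Finset.card_univ, Fintype.card_fin]
  have h1 : (∑ D ∈ P.powerset, ((baxterPerms Dᶜ.card).card : ℝ)) ≤ (baxterArrays n).ncard := by
    exact_mod_cast sum_card_baxterPerms_le n
  -- Binomial expansion of `(1 + 8) ^ (n - 1)` over the subsets of the positions other than the
  -- first.
  have h2 : (9 : ℝ) ^ (n - 1) = ∑ D ∈ P.powerset, 1 ^ D.card * 8 ^ (P.card - D.card) := by
    rw [Finset.sum_pow_mul_eq_add_pow, hPcard]; norm_num
  rw [h2]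
  refine le_trans ?_ (mul_le_mul_of_nonneg_left h1 (by positivity))
  rw [Finset.mul_sum]
  refine Finset.sum_le_sum fun D hD => ?_
  have hle : D.card ≤ n - 1 := hPcard ▸ Finset.card_le_card (Finset.mem_powerset.mp hD)
  have hc : Dᶜ.card = n - D.card := by rw [Finset.card_compl, Fintype.card_fin]
  have h3 := eight_pow_le_card_baxterPerms (n := Dᶜ.card) (by omega)
  have h4 : (8 : ℝ) ^ Dᶜ.card = 8 * 8 ^ (P.card - D.card) := by
    rw [hc, hPcard, ← pow_succ']; congr 1; omega
  have h5 : (Dᶜ.card : ℝ) ≤ n := by rw [hc]; exact_mod_cast Nat.sub_le _ _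
  rw [h4] at h3
  have h6 : (8 : ℝ) ^ (P.card - D.card) ≤ (Dᶜ.card + 1) ^ 6 * (baxterPerms Dᶜ.card).card := by
    linarith
  rw [one_pow, one_mul]
  exact h6.trans (by gcongr)

/-! ### Reconstruction of the array from the queries. -/

theorem mem_minPositions_iff_exists_rangeMin {n : ℕ} {α : Type*} [LinearOrder α] {A : Fin n → α}
    {i j : Fin n} (h : i ≤ j) (p : Fin n) :
    p ∈ minPositions A i j ↔ ∃ Q : RangeQuery n, Q.lo = i ∧ Q.hi = j ∧ rangeMin A Q = p := by
  constructor
  · intro hp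
    have hp' : p ∈ Set.range ((minPositions A i j).orderEmbOfFin rfl) := by
      rw [Finset.range_orderEmbOfFin]; exact hp
    obtain ⟨t, rfl⟩ := hp'
    refine ⟨⟨i, j, t + 1, h, by omega⟩, rfl, rfl, ?_⟩
    simp only [rangeMin]
    congr 1
    ext
    simp only
    have := t.isLt
    omega
  · rintro ⟨Q, rfl, rfl, rfl⟩
    exact Finset.orderEmbOfFin_mem _ _ _

theorem minPositions_eq_of_rangeMin_eq {n : ℕ} {α : Type*} [LinearOrder α] {A B : Fin n → α}
    (hAB : rangeMin A = rangeMin B) {i j : Fin n} (h : i ≤ j) :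
    minPositions A i j = minPositions B i j := by
  ext p
  rw [mem_minPositions_iff_exists_rangeMin h, mem_minPositions_iff_exists_rangeMin h, hAB]

theorem mem_minPositions {n : ℕ} {α : Type*} [LinearOrder α] {A : Fin n → α} {i j p : Fin n} :
    p ∈ minPositions A i j ↔ (i ≤ p ∧ p ≤ j) ∧ ∀ r, i ≤ r → r ≤ j → A p ≤ A r := by
  simp [minPositions]

/-- The array has no occurrence of the pattern `3-14-2`. -/
def AvoidsAscent {n : ℕ} {α : Type*} [LinearOrder α] (A : Fin n → α) : Prop :=
  ∀ i j j' l : Fin n, i < j → (j' : ℕ) = j + 1 → j' < l → ¬ (A j < A l ∧ A l < A i ∧ A i < A j')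

/-- Take the last position in `[a, b]` with value below `A l`. Its right neighbour has value at
least `A l`, and a value above `A i` would complete a `3-14-2`. -/
theorem AvoidsAscent.exists_between {n : ℕ} {α : Type*} [LinearOrder α] {A : Fin n → α}
    (hA : AvoidsAscent A) {i a b l : Fin n} (hia : i < a) (hab : a < b) (hbl : b < l)
    (ha : A a < A l) (hb : A i < A b) (h : A l < A i) :
    ∃ c, i < c ∧ c < l ∧ A l ≤ A c ∧ A c ≤ A i := by
  set S := (Finset.Icc a b).filter fun c => A c < A l with hS
  have hne : S.Nonempty := ⟨a, by simp [hS, hab.le, ha]⟩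
  obtain ⟨hx, hxl⟩ := Finset.mem_filter.mp (S.max'_mem hne)
  set x := S.max' hne with hxdef
  obtain ⟨hax, hxb⟩ := Finset.mem_Icc.mp hx
  have hxb' : x < b := lt_of_le_of_ne hxb fun hc => by
    rw [hc] at hxl
    exact lt_asymm (hxl.trans h) hb
  have hlt : (x : ℕ) + 1 ≤ b := hxb'
  obtain ⟨y, hy⟩ : ∃ y : Fin n, (y : ℕ) = x + 1 := ⟨⟨x + 1, hlt.trans_lt b.isLt⟩, rfl⟩
  have hyb : y ≤ b := by rw [Fin.le_def]; omega
  have hxy : x < y := by rw [Fin.lt_def]; omega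
  have hyl : A l ≤ A y := by
    by_contra hc
    have : y ∈ S := by
      rw [hS, Finset.mem_filter, Finset.mem_Icc]
      exact ⟨⟨hax.trans hxy.le, hyb⟩, not_le.mp hc⟩
    exact absurd (S.le_max' y this) (not_le.mpr hxy)
  refine ⟨y, hia.trans_le (hax.trans hxy.le), hyb.trans_lt hbl, hyl, ?_⟩
  by_contra hc
  exact hA i x y l (hia.trans_le hax) hy (hyb.trans_lt hbl) ⟨hxl, h, not_le.mp hc⟩

/-- The functions `A` and `B` order the positions `x` and `y` in the same way. -/
def SameOrder {n : ℕ} {α : Type*} [LinearOrder α] (A B : Fin n → α) (x y : Fin n) : Prop :=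
  (A x ≤ A y ↔ B x ≤ B y) ∧ (A y ≤ A x ↔ B y ≤ B x)

theorem SameOrder.symm {n : ℕ} {α : Type*} [LinearOrder α] {A B : Fin n → α} {x y : Fin n}
    (h : SameOrder A B x y) : SameOrder B A x y := ⟨h.1.symm, h.2.symm⟩

theorem SameOrder.swap {n : ℕ} {α : Type*} [LinearOrder α] {A B : Fin n → α} {x y : Fin n}
    (h : SameOrder A B x y) : SameOrder A B y x := ⟨h.2, h.1⟩

/-- The intermediate position `c` transfers `A l ≤ A c ≤ A i` to `B`. If `B i ≤ B l` held, the three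
`B` values would agree, and pulling this back would give `A i ≤ A l`. -/
theorem AvoidsAscent.lt_of_lt {n : ℕ} {α : Type*} [LinearOrder α] {A B : Fin n → α}
    (hA : AvoidsAscent A) {i a b l : Fin n} (hia : i < a) (hab : a < b) (hbl : b < l)
    (ha : A a < A l) (hb : A i < A b)
    (ih : ∀ x y, i ≤ x → x < y → y ≤ l → (i < x ∨ y < l) → SameOrder A B x y) (h : A l < A i) :
    B l < B i := by
  obtain ⟨c, hic, hcl, h1, h2⟩ := hA.exists_between hia hab hbl ha hb h
  have o1 := ih i c le_rfl hic hcl.le (Or.inr hcl)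
  have o2 := ih c l hic.le hcl le_rfl (Or.inl hic)
  by_contra hc
  have h3 := o2.2.mp h1
  have h4 := o1.2.mp h2
  have h5 := o2.1.mpr (h4.trans (not_lt.mp hc))
  have h6 := o1.1.mpr ((not_lt.mp hc).trans h3)
  exact absurd (h6.trans h5) (not_le.mpr h)

/-- The structural properties of the arrays in `baxterArrays`, up to an order isomorphism of the
values. -/
structure IsBaxterArray {n : ℕ} {α : Type*} [LinearOrder α] (A : Fin n → α) : Prop where
  ascent : AvoidsAscent A
  descent : AvoidsAscent fun p => OrderDual.toDual (A p)
  contiguous : ∀ r s t, r ≤ s → s ≤ t → A r = A t → A s = A r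

theorem IsBaxterArray.sameOrder {n : ℕ} {α : Type*} [LinearOrder α] {A B : Fin n → α}
    (hA : IsBaxterArray A) (hB : IsBaxterArray B) (hmin : rangeMin A = rangeMin B)
    (hmax : rangeMax A = rangeMax B) : ∀ i l, i < l → SameOrder A B i l := by
  suffices H : ∀ d : ℕ, ∀ i l : Fin n, i < l → (l : ℕ) = i + d → SameOrder A B i l from
    fun i l h => H (l - i) i l h (by rw [Fin.lt_def] at h; omega)
  intro d
  induction d using Nat.strong_induction_on with
  | _ d IH =>
  intro i l hil hd
  have ih : ∀ x y, i ≤ x → x < y → y ≤ l → (i < x ∨ y < l) → SameOrder A B x y := by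
    intro x y hx hxy hy hor
    simp only [Fin.lt_def, Fin.le_def] at hx hxy hy hor
    exact IH (y - x) (by omega) x y hxy (by omega)
  have emin : ∀ p, ((i ≤ p ∧ p ≤ l) ∧ ∀ r, i ≤ r → r ≤ l → A p ≤ A r) ↔
      ((i ≤ p ∧ p ≤ l) ∧ ∀ r, i ≤ r → r ≤ l → B p ≤ B r) := fun p => by
    rw [← mem_minPositions, ← mem_minPositions, minPositions_eq_of_rangeMin_eq hmin hil.le]
  have emax : ∀ p, ((i ≤ p ∧ p ≤ l) ∧ ∀ r, i ≤ r → r ≤ l → A r ≤ A p) ↔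
      ((i ≤ p ∧ p ≤ l) ∧ ∀ r, i ≤ r → r ≤ l → B r ≤ B p) := fun p => by
    have h : ∀ C : Fin n → α, (∀ r, i ≤ r → r ≤ l → C r ≤ C p) ↔
      ∀ r, i ≤ r → r ≤ l → OrderDual.toDual (C p) ≤ OrderDual.toDual (C r) := fun C => Iff.rfl
    rw [h, h, ← mem_minPositions (A := fun p => OrderDual.toDual (A p)),
      ← mem_minPositions (A := fun p => OrderDual.toDual (B p)),
      minPositions_eq_of_rangeMin_eq (A := fun p => OrderDual.toDual (A p))
        (B := fun p => OrderDual.toDual (B p)) (funext fun Q => congrFun hmax Q) hil.le]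
  -- An extremal end point determines the comparison of the two ends.
  have ends : ∀ {C D : Fin n → α} {x y : Fin n},
      (∀ p, ((i ≤ p ∧ p ≤ l) ∧ ∀ r, i ≤ r → r ≤ l → C p ≤ C r) ↔
        ((i ≤ p ∧ p ≤ l) ∧ ∀ r, i ≤ r → r ≤ l → D p ≤ D r)) →
      (i ≤ x ∧ x ≤ l) → (i ≤ y ∧ y ≤ l) → (∀ r, i ≤ r → r ≤ l → C x ≤ C r) →
      (C y ≤ C x → D y ≤ D x) ∧ C x ≤ C y ∧ D x ≤ D y := by
    intro C D x y e hx hy hm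
    refine ⟨fun h => ?_, hm y hy.1 hy.2, ((e x).mp ⟨hx, hm⟩).2 y hy.1 hy.2⟩
    exact ((e y).mp ⟨hy, fun r h1 h2 => h.trans (hm r h1 h2)⟩).2 x hx.1 hx.2
  have ends' : ∀ {C D : Fin n → α} {x y : Fin n},
      (∀ p, ((i ≤ p ∧ p ≤ l) ∧ ∀ r, i ≤ r → r ≤ l → C r ≤ C p) ↔
        ((i ≤ p ∧ p ≤ l) ∧ ∀ r, i ≤ r → r ≤ l → D r ≤ D p)) →
      (i ≤ x ∧ x ≤ l) → (i ≤ y ∧ y ≤ l) → (∀ r, i ≤ r → r ≤ l → C r ≤ C x) →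
      (C x ≤ C y → D x ≤ D y) ∧ C y ≤ C x ∧ D y ≤ D x := by
    intro C D x y e hx hy hm
    refine ⟨fun h => ?_, hm y hy.1 hy.2, ((e x).mp ⟨hx, hm⟩).2 y hy.1 hy.2⟩
    exact ((e y).mp ⟨hy, fun r h1 h2 => (hm r h1 h2).trans h⟩).2 x hx.1 hx.2
  have minEnd : ∀ {x y : Fin n}, (i ≤ x ∧ x ≤ l) → (i ≤ y ∧ y ≤ l) →
      (∀ r, i ≤ r → r ≤ l → A x ≤ A r) → SameOrder A B x y := by
    intro x y hx hy hm
    obtain ⟨h1, h2, h3⟩ := ends emin hx hy hm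
    exact ⟨iff_of_true h2 h3,
      h1, (ends (fun p => (emin p).symm) hx hy ((emin x).mp ⟨hx, hm⟩).2).1⟩
  have maxEnd : ∀ {x y : Fin n}, (i ≤ x ∧ x ≤ l) → (i ≤ y ∧ y ≤ l) →
      (∀ r, i ≤ r → r ≤ l → A r ≤ A x) → SameOrder A B x y := by
    intro x y hx hy hm
    obtain ⟨h1, h2, h3⟩ := ends' emax hx hy hm
    exact ⟨⟨h1, (ends' (fun p => (emax p).symm) hx hy ((emax x).mp ⟨hx, hm⟩).2).1⟩,
      iff_of_true h2 h3⟩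
  have hi : i ≤ i ∧ i ≤ l := ⟨le_rfl, hil.le⟩
  have hl : i ≤ l ∧ l ≤ l := ⟨hil.le, le_rfl⟩
  by_cases c1 : ∀ r, i ≤ r → r ≤ l → A i ≤ A r
  · exact minEnd hi hl c1
  by_cases c2 : ∀ r, i ≤ r → r ≤ l → A l ≤ A r
  · exact (minEnd hl hi c2).swap
  by_cases c3 : ∀ r, i ≤ r → r ≤ l → A r ≤ A i
  · exact maxEnd hi hl c3
  by_cases c4 : ∀ r, i ≤ r → r ≤ l → A r ≤ A l
  · exact (maxEnd hl hi c4).swap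
  -- Neither end is extremal, so the extremal positions `a` and `b` lie strictly inside, and they
  -- serve for `B` as well.
  obtain ⟨a, haI, ha⟩ := Finset.exists_min_image (Finset.Icc i l) A ⟨i, by simpa using hi⟩
  obtain ⟨b, hbI, hb⟩ := Finset.exists_max_image (Finset.Icc i l) A ⟨i, by simpa using hi⟩
  rw [Finset.mem_Icc] at haI hbI
  have ha : ∀ r, i ≤ r → r ≤ l → A a ≤ A r := fun r h1 h2 => ha r (Finset.mem_Icc.mpr ⟨h1, h2⟩)
  have hb : ∀ r, i ≤ r → r ≤ l → A r ≤ A b := fun r h1 h2 => hb r (Finset.mem_Icc.mpr ⟨h1, h2⟩)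
  have ha' := ((emin a).mp ⟨haI, ha⟩).2
  have hb' := ((emax b).mp ⟨hbI, hb⟩).2
  have d1 : ¬ ∀ r, i ≤ r → r ≤ l → B i ≤ B r := fun h => c1 ((emin i).mpr ⟨hi, h⟩).2
  have d2 : ¬ ∀ r, i ≤ r → r ≤ l → B l ≤ B r := fun h => c2 ((emin l).mpr ⟨hl, h⟩).2
  have d3 : ¬ ∀ r, i ≤ r → r ≤ l → B r ≤ B i := fun h => c3 ((emax i).mpr ⟨hi, h⟩).2
  have d4 : ¬ ∀ r, i ≤ r → r ≤ l → B r ≤ B l := fun h => c4 ((emax l).mpr ⟨hl, h⟩).2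
  have ltmin : ∀ {C : Fin n → α} {x : Fin n}, (∀ r, i ≤ r → r ≤ l → C a ≤ C r) →
      (¬ ∀ r, i ≤ r → r ≤ l → C x ≤ C r) → C a < C x := fun {C x} h1 h2 =>
    not_le.mp fun hc => h2 fun r hr1 hr2 => hc.trans (h1 r hr1 hr2)
  have ltmax : ∀ {C : Fin n → α} {x : Fin n}, (∀ r, i ≤ r → r ≤ l → C r ≤ C b) →
      (¬ ∀ r, i ≤ r → r ≤ l → C r ≤ C x) → C x < C b := fun {C x} h1 h2 =>
    not_le.mp fun hc => h2 fun r hr1 hr2 => (h1 r hr1 hr2).trans hc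
  have Aai := ltmin ha c1
  have Aal := ltmin ha c2
  have Aib := ltmax hb c3
  have Alb := ltmax hb c4
  have Bai := ltmin ha' d1
  have Bal := ltmin ha' d2
  have Bib := ltmax hb' d3
  have Blb := ltmax hb' d4
  have hia : i < a := lt_of_le_of_ne haI.1 fun h => lt_irrefl _ (h ▸ Aai)
  have hal : a < l := lt_of_le_of_ne haI.2 fun h => lt_irrefl _ (h ▸ Aal)
  have hib : i < b := lt_of_le_of_ne hbI.1 fun h => lt_irrefl _ (h ▸ Aib)
  have hbl : b < l := lt_of_le_of_ne hbI.2 fun h => lt_irrefl _ (h ▸ Alb)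
  have neA : A i ≠ A l := fun h => Aai.ne (hA.contiguous i a l hia.le hal.le h)
  have neB : B i ≠ B l := fun h => Bai.ne (hB.contiguous i a l hia.le hal.le h)
  have ih' : ∀ x y, i ≤ x → x < y → y ≤ l → (i < x ∨ y < l) → SameOrder B A x y :=
    fun x y h1 h2 h3 h4 => (ih x y h1 h2 h3 h4).symm
  -- One strict comparison suffices, since the ends differ in both arrays; the order of `a` and `b`
  -- decides which pattern, and hence which comparison, is used.
  have key : (A l < A i ↔ B l < B i) ∨ (A i < A l ↔ B i < B l) := by
    rcases lt_trichotomy a b with hab | hab | hab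
    · exact Or.inl ⟨hA.ascent.lt_of_lt hia hab hbl Aal Aib ih,
        hB.ascent.lt_of_lt hia hab hbl Bal Bib ih'⟩
    · rw [hab] at Aai
      exact absurd Aai (lt_asymm Aib)
    · refine Or.inr ⟨fun h => ?_, fun h => ?_⟩
      · exact hA.descent.lt_of_lt (B := fun p => OrderDual.toDual (B p)) hib hab hal Alb Aai
          (fun x y h1 h2 h3 h4 => (ih x y h1 h2 h3 h4).swap) h
      · exact hB.descent.lt_of_lt (B := fun p => OrderDual.toDual (A p)) hib hab hal Blb Bai
          (fun x y h1 h2 h3 h4 => (ih' x y h1 h2 h3 h4).swap) h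
  have fA : A i ≤ A l ↔ ¬ A l ≤ A i := ⟨fun h => not_le.mpr (lt_of_le_of_ne h neA),
    fun h => (not_le.mp h).le⟩
  have fB : B i ≤ B l ↔ ¬ B l ≤ B i := ⟨fun h => not_le.mpr (lt_of_le_of_ne h neB),
    fun h => (not_le.mp h).le⟩
  simp only [← not_le] at key
  rcases key with k | k
  · have k := not_iff_not.mp k
    exact ⟨k, not_iff_not.mp (by rw [← fA, ← fB]; exact k)⟩
  · have k := not_iff_not.mp k
    exact ⟨by rw [fA, fB, k], k⟩

/-- A pattern in the array projects to the block indices: adjacent positions with different values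
lie in consecutive blocks, so adjacency survives. -/
theorem IsBaxter.isBaxterArray_blockArray {n : ℕ} {D : Finset (Fin n)}
    {hD : ∀ p ∈ D, 0 < (p : ℕ)} {π : Equiv.Perm (Fin Dᶜ.card)} (hπ : IsBaxter π) :
    IsBaxterArray (blockArray D hD π) := by
  have lt_of : ∀ {x y : Fin n}, x ≤ y → blockArray D hD π x ≠ blockArray D hD π y →
      blockIndex D x < blockIndex D y := fun {x y} h hne =>
    lt_of_le_of_ne (blockIndex_mono D h) fun hc => hne (blockArray_eq_iff.mpr hc)
  have succ_of : ∀ {x y : Fin n}, (y : ℕ) = x + 1 → blockArray D hD π x ≠ blockArray D hD π y →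
      blockIndex D y = blockIndex D x + 1 := fun {x y} h hne =>
    blockIndex_succ_of_notMem hD h fun hc => hne ((mem_iff_blockArray_eq h).mp hc).symm
  have val : ∀ {x y : Fin n}, blockArray D hD π x < blockArray D hD π y ↔
      π ⟨blockIndex D x, blockIndex_lt hD x⟩ < π ⟨blockIndex D y, blockIndex_lt hD y⟩ := by
    intro x y; simp [blockArray]
  refine ⟨?_, ?_, ?_⟩
  · rintro i j j' l hij hj hl ⟨h1, h2, h3⟩
    exact (hπ ⟨blockIndex D i, blockIndex_lt hD i⟩ ⟨blockIndex D j, blockIndex_lt hD j⟩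
      ⟨blockIndex D j', blockIndex_lt hD j'⟩ ⟨blockIndex D l, blockIndex_lt hD l⟩
      (lt_of hij.le (h1.trans h2).ne') (succ_of hj ((h1.trans h2).trans h3).ne)
      (lt_of hl.le (h2.trans h3).ne')).2 ⟨val.mp h1, val.mp h2, val.mp h3⟩
  · rintro i j j' l hij hj hl ⟨h1, h2, h3⟩
    rw [OrderDual.toDual_lt_toDual] at h1 h2 h3
    exact (hπ ⟨blockIndex D i, blockIndex_lt hD i⟩ ⟨blockIndex D j, blockIndex_lt hD j⟩
      ⟨blockIndex D j', blockIndex_lt hD j'⟩ ⟨blockIndex D l, blockIndex_lt hD l⟩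
      (lt_of hij.le (h2.trans h1).ne) (succ_of hj ((h3.trans h2).trans h1).ne')
      (lt_of hl.le (h3.trans h2).ne)).1 ⟨val.mp h3, val.mp h2, val.mp h1⟩
  · intro r s t hrs hst h
    rw [blockArray_eq_iff] at h ⊢
    exact le_antisymm ((blockIndex_mono D hst).trans h.ge) (blockIndex_mono D hrs)

theorem isBaxterArray_of_mem {n : ℕ} {A : Fin n → ℕ} (hA : A ∈ baxterArrays n) :
    IsBaxterArray A := by
  obtain ⟨D, hD, π, hπ, rfl⟩ := exists_blockArray_of_mem hA
  exact hπ.isBaxterArray_blockArray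

/-- The values form an initial segment `1, …, m`, so each equals its rank among the distinct values;
the order alone thus fixes the array. -/
theorem card_image_filter_le_of_mem {n : ℕ} {A : Fin n → ℕ} (hA : A ∈ baxterArrays n)
    (p : Fin n) : ((Finset.univ.filter fun q => A q ≤ A p).image A).card = A p := by
  obtain ⟨D, hD, π, hπ, rfl⟩ := exists_blockArray_of_mem hA
  suffices H : (Finset.univ.filter fun q => blockArray D hD π q ≤ blockArray D hD π p).image
      (blockArray D hD π) = Finset.Icc 1 (blockArray D hD π p) by
    rw [H, Nat.card_Icc]; omega
  ext v
  simp only [Finset.mem_image, Finset.mem_filter, Finset.mem_univ, true_and, Finset.mem_Icc]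
  constructor
  · rintro ⟨q, hq, rfl⟩
    exact ⟨Nat.succ_le_succ (Nat.zero_le _), hq⟩
  · rintro ⟨h1, h2⟩
    have hv : v - 1 < Dᶜ.card := by
      have := (π ⟨blockIndex D p, blockIndex_lt hD p⟩).isLt
      simp only [blockArray] at h2
      omega
    have : blockArray D hD π (Dᶜ.orderEmbOfFin rfl (π.symm ⟨v - 1, hv⟩)) = v := by
      simp only [blockArray, blockIndex_orderEmbOfFin, Fin.eta, Equiv.apply_symm_apply]
      omega
    exact ⟨_, by rw [this]; exact h2, this⟩

theorem card_image_le_of_factors {ι α β : Type*} [Nonempty β] [DecidableEq α] [DecidableEq β]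
    {f : ι → α} {g : ι → β} (h : ∀ x y, f x = f y → g x = g y) (S : Finset ι) :
    (S.image g).card ≤ (S.image f).card := by
  have hfg : g.FactorsThrough f := fun x y hxy => h x y hxy
  have : S.image g = (S.image f).image (Function.extend f g fun _ => Classical.arbitrary β) := by
    rw [Finset.image_image]
    exact Finset.image_congr fun x _ => (hfg.extend_apply _ x).symm
  rw [this]
  exact Finset.card_image_le

/-- The range minimum and maximum queries determine the arrays in `baxterArrays`. -/
theorem eq_of_rangeMin_eq_of_rangeMax_eq {n : ℕ} {A B : Fin n → ℕ} (hA : A ∈ baxterArrays n)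
    (hB : B ∈ baxterArrays n) (hmin : rangeMin A = rangeMin B) (hmax : rangeMax A = rangeMax B) :
    A = B := by
  have ho := (isBaxterArray_of_mem hA).sameOrder (isBaxterArray_of_mem hB) hmin hmax
  have hle : ∀ x y, A x ≤ A y ↔ B x ≤ B y := fun x y => by
    rcases lt_trichotomy x y with h | rfl | h
    · exact (ho x y h).1
    · exact iff_of_true le_rfl le_rfl
    · exact (ho y x h).2
  have heq : ∀ x y, A x = A y ↔ B x = B y := fun x y => by
    rw [le_antisymm_iff, le_antisymm_iff, hle, hle]
  ext p
  rw [← card_image_filter_le_of_mem hA p, ← card_image_filter_le_of_mem hB p]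
  simp only [hle]
  exact le_antisymm (card_image_le_of_factors (fun x y => (heq x y).mpr) _)
    (card_image_le_of_factors (fun x y => (heq x y).mp) _)

/-! ### From counting to the length of encodings. -/

/-- The number whose binary digits are `1` followed by the reversed bit string. -/
def bitCode : List Bool → ℕ
  | [] => 1
  | b :: l => 2 * bitCode l + b.toNat

theorem bitCode_pos (l : List Bool) : 1 ≤ bitCode l := by
  induction l with
  | nil => exact le_rfl
  | cons b l ih => simp only [bitCode]; omega

theorem bitCode_lt (l : List Bool) : bitCode l < 2 ^ (l.length + 1) := by
  induction l with
  | nil => simp [bitCode]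
  | cons b l ih =>
    have := b.toNat_lt
    rw [bitCode, List.length_cons, pow_succ]
    omega

/-- The leading `1` marks the length, so trailing `false` entries are not lost. -/
theorem bitCode_injective : Function.Injective bitCode := by
  intro l
  induction l with
  | nil =>
    intro l' h
    cases l' with
    | nil => rfl
    | cons b l' =>
      have := bitCode_pos l'
      simp only [bitCode] at h
      omega
  | cons b l ih =>
    intro l' h
    cases l' with
    | nil =>
      have := bitCode_pos l
      simp only [bitCode] at h
      omega
    | cons b' l' =>
      have h1 := b.toNat_lt
      have h2 := b'.toNat_lt
      simp only [bitCode] at h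
      have e1 : bitCode l = bitCode l' := by omega
      have e2 : b.toNat = b'.toNat := by omega
      have e3 : b = b' := by cases b <;> cases b' <;> simp_all
      rw [ih e1, e3]

theorem ncard_lt_two_pow_of_length_le {α : Type*} {s : Set α} {e : α → List Bool}
    (he : Set.InjOn e s) {K : ℕ} (hK : ∀ a ∈ s, (e a).length ≤ K) : s.ncard < 2 ^ (K + 1) := by
  have h := Set.ncard_le_ncard_of_injOn (s := s)
    (t := (Finset.Ico 1 (2 ^ (K + 1)) : Finset ℕ)) (fun a => bitCode (e a))
    (fun a ha => by
      rw [Finset.coe_Ico, Set.mem_Ico]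
      exact ⟨bitCode_pos _, (bitCode_lt _).trans_le
        (Nat.pow_le_pow_right (by norm_num) (Nat.succ_le_succ (hK a ha)))⟩)
    (fun a ha b hb hab => he ha hb (bitCode_injective hab)) (Finset.finite_toSet _)
  rw [Set.ncard_coe_finset, Nat.card_Ico] at h
  have : 0 < 2 ^ (K + 1) := by positivity
  omega

/-- The exponent is `17 = 5 + 2 * 6`, from `18 ≤ n ^ 5` and `n + 1 ≤ n ^ 2`. The factor `2` reserves
the bit lost because there are almost `2 ^ (K + 1)` strings of length at most `K`. -/
theorem two_mul_nine_pow_le {n : ℕ} (hn : 2 ≤ n) :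
    (2 : ℝ) * 9 ^ n ≤ (baxterArrays n).ncard * (n : ℝ) ^ 17 := by
  have h := nine_pow_le_ncard_baxterArrays (n := n) (by omega)
  have hn' : (2 : ℝ) ≤ n := by exact_mod_cast hn
  have h9 : (9 : ℝ) ^ n = 9 * 9 ^ (n - 1) := by rw [← pow_succ']; congr 1; omega
  have h1 : (n + 1 : ℝ) ≤ n ^ 2 := by nlinarith
  have h2 : (18 : ℝ) ≤ n ^ 5 := by
    calc (18 : ℝ) ≤ 2 ^ 5 := by norm_num
      _ ≤ _ := by gcongr
  calc (2 : ℝ) * 9 ^ n = 18 * 9 ^ (n - 1) := by rw [h9]; ring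
    _ ≤ n ^ 5 * ((n ^ 2) ^ 6 * (baxterArrays n).ncard) := by
      gcongr
      exact h.trans (by gcongr)
    _ = _ := by ring

theorem add_one_le_logb_ncard_baxterArrays {n : ℕ} (hn : 2 ≤ n) :
    n * Real.logb 2 9 - 17 * Real.logb 2 n + 1 ≤ Real.logb 2 (baxterArrays n).ncard := by
  have h := two_mul_nine_pow_le hn
  have hn0 : (0 : ℝ) < n := by exact_mod_cast (by omega : 0 < n)
  have hN : (0 : ℝ) < (baxterArrays n).ncard := by
    refine lt_of_le_of_ne (Nat.cast_nonneg _) fun hc => ?_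
    rw [← hc, zero_mul] at h
    exact absurd h (not_le.mpr (by positivity))
  have h' := Real.logb_le_logb_of_le (b := 2) (by norm_num) (by positivity) h
  rw [Real.logb_mul (by norm_num) (by positivity), Real.logb_mul hN.ne' (by positivity),
    Real.logb_pow, Real.logb_pow, Real.logb_self_eq_one (by norm_num)] at h'
  push_cast at h'
  linarith

/-- Since `3.16 = 79 / 25`, this is `2 ^ 79 ≤ 9 ^ 25`. -/
theorem le_logb_two_nine : (3.16 : ℝ) ≤ Real.logb 2 9 := by
  have h : Real.logb 2 ((2 : ℝ) ^ 79) ≤ Real.logb 2 ((9 : ℝ) ^ 25) :=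
    Real.logb_le_logb_of_le (by norm_num) (by norm_num) (by norm_num)
  rw [Real.logb_pow, Real.logb_pow, Real.logb_self_eq_one (by norm_num)] at h
  push_cast at h
  linarith

theorem exists_encoding_length_ge {n : ℕ} (hn : 2 ≤ n) {S : Set (Fin n → ℕ)}
    (hS : baxterArrays n ⊆ S) {enc : S → List Bool} (henc : SupportsRangeQueries S enc) :
    ∃ A : S, (A : Fin n → ℕ) ∈ baxterArrays n ∧
      n * Real.logb 2 9 - 17 * Real.logb 2 n ≤ ((enc A).length : ℝ) := by
  obtain ⟨ansMin, ansMax, hans⟩ := henc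
  have hlog := add_one_le_logb_ncard_baxterArrays hn
  set x := n * Real.logb 2 9 - 17 * Real.logb 2 n with hx
  have hN : 0 < (baxterArrays n).ncard := by
    refine Nat.pos_of_ne_zero fun hc => ?_
    have := two_mul_nine_pow_le hn
    rw [hc, Nat.cast_zero, zero_mul] at this
    exact absurd this (not_le.mpr (by positivity))
  by_contra! hlt
  set s : Set S := {A | (A : Fin n → ℕ) ∈ baxterArrays n} with hs
  have hsN : s.ncard = (baxterArrays n).ncard := by
    rw [← Set.ncard_image_of_injective s Subtype.val_injective]
    congr 1
    ext A
    simp only [hs, Set.mem_image, Set.mem_ofPred_eq]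
    exact ⟨by rintro ⟨B, hB, rfl⟩; exact hB, fun hA => ⟨⟨A, hS hA⟩, hA, rfl⟩⟩
  have hinj : Set.InjOn enc s := by
    intro A hA B hB hAB
    refine Subtype.ext (eq_of_rangeMin_eq_of_rangeMax_eq hA hB (funext fun Q => ?_)
      (funext fun Q => ?_))
    · rw [← (hans A Q).1, ← (hans B Q).1, hAB]
    · rw [← (hans A Q).2, ← (hans B Q).2, hAB]
  have hlen : ∀ A ∈ s, (enc A).length ≤ ⌊x⌋₊ := fun A hA => Nat.le_floor (hlt A hA).le
  have hcard := ncard_lt_two_pow_of_length_le hinj hlen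
  rw [hsN] at hcard
  obtain ⟨A, hA⟩ : s.Nonempty := by
    rw [Set.nonempty_iff_ne_empty]
    intro hc
    rw [hc, Set.ncard_empty] at hsN
    omega
  have hx0 : 0 ≤ x := (Nat.cast_nonneg _).trans (hlt A hA).le
  have h1 : Real.logb 2 (baxterArrays n).ncard < Real.logb 2 ((2 : ℝ) ^ (⌊x⌋₊ + 1)) :=
    Real.logb_lt_logb (by norm_num) (by exact_mod_cast hN) (by exact_mod_cast hcard)
  rw [Real.logb_pow, Real.logb_self_eq_one (by norm_num)] at h1
  push_cast at h1
  have := Nat.floor_le hx0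
  linarith

theorem theorem4 :
    (∀ n : ℕ, 2 ≤ n →
      ∃ reconstruct : (RangeQuery n → Fin n) → (RangeQuery n → Fin n) → (Fin n → ℕ),
        ∀ A ∈ baxterArrays n, reconstruct (rangeMin A) (rangeMax A) = A) ∧
    (∃ f : ℕ → ℝ, f =Θ[Filter.atTop] (fun n : ℕ => Real.logb 2 (n : ℝ)) ∧
      ∀ n : ℕ, 2 ≤ n →
        (3.16 : ℝ) * n - f n ≤ n * Real.logb 2 9 - f n ∧
        n * Real.logb 2 9 - f n ≤ Real.logb 2 ((baxterArrays n).ncard : ℝ) ∧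
        ∀ (S : Set (Fin n → ℕ)), baxterArrays n ⊆ S →
          ∀ enc : S → List Bool, SupportsRangeQueries S enc →
            ∃ A : S, (A : Fin n → ℕ) ∈ baxterArrays n ∧
              n * Real.logb 2 9 - f n ≤ ((enc A).length : ℝ)) := by
  classical
  refine ⟨fun n _ => ?_, fun n => 17 * Real.logb 2 n, ?_, fun n hn => ⟨?_, ?_, ?_⟩⟩
  -- Any array of the class with the given answers may be chosen, because there is at most one; `0`
  -- is a dummy for impossible answers.
  · refine ⟨fun m M => if h : ∃ A ∈ baxterArrays n, rangeMin A = m ∧ rangeMax A = M then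
      h.choose else 0, fun A hA => ?_⟩
    have h : ∃ B ∈ baxterArrays n, rangeMin B = rangeMin A ∧ rangeMax B = rangeMax A :=
      ⟨A, hA, rfl, rfl⟩
    simp only [dif_pos h]
    obtain ⟨h1, h2, h3⟩ := h.choose_spec
    exact eq_of_rangeMin_eq_of_rangeMax_eq h1 hA h2 h3
  · exact (Asymptotics.isTheta_const_mul_left (by norm_num)).mpr (Asymptotics.isTheta_refl _ _)
  · have := mul_le_mul_of_nonneg_right le_logb_two_nine (Nat.cast_nonneg (α := ℝ) n)
    linarith
  · linarith [add_one_le_logb_ncard_baxterArrays hn]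
  · exact fun S hS enc henc => exists_encoding_length_ge hn hS henc
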